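/- All simplicial complexes are finite, and the empty set is a face of each of them. Let $t\ge 2$ be an integer and let $\lambda=(\lambda_1,\dots,\lambda_r)$ be a partition with $r\ge 1$ and $\lambda_1\ge\lambda_2\ge\cdots\ge\lambda_r\ge 1$. Fill the Young diagram of $\lambda$ by writing the numbers $(r-j)t+1,(r-j)t+2,\dots,(r-j)t+\lambda_j$ from left to right in the $j$-th row from the top ($1\le j\le r$). The $t$-Young complex $\Delta_t^\lambda$ is the simplicial complex on the integers generated by all sets $\{a_1,\dots,a_{\lambda_1}\}$ such that $a_1<a_2<\cdots<a_{\lambda_1}$ and $a_j$ is an entry of the $j$-th column for every $1\le j\le\lambda_1$. Let $K$ be any field. A simplicial complex $\Delta$ is called - vertex decomposable if it is a simplex (possibly $\{\emptyset\}$), or if, recursively, it has a vertex $x$ such that every facet of the deletion $\{\sigma\in\Delta: x\notin\sigma\}$ is a facet of $\Delta$ and both the deletion and the link of $x$ are vertex decomposable; - shellable if it is pure and its facets can be ordered $F_1,\dots,F_m$ so that for each $i\ge 2$ the complex $\langle F_1,\dots,F_{i-1}\rangle\cap\langle F_i\rangle$ is generated by a non-empty set of maximal proper faces of $F_i$; -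 Cohen–Macaulay over $K$ if for every face $\sigma$ of $\Delta$ (including $\sigma=\emptyset$) and every $i<\dim(\operatorname{lk}_\Delta\sigma)$ one has $\widetilde H_i(\operatorname{lk}_\Delta\sigma;K)=0$, where $\operatorname{lk}_\Delta\sigma=\{\tau\in\Delta:\tau\cap\sigma=\emptyset,\ \tau\cup\sigma\in\Delta\}$. Then the following are equivalent: 1. $\Delta_t^\lambda$ is vertex decomposable; 2. $\Delta_t^\lambda$ is shellable; 3. $\Delta_t^\lambda$ is Cohen–Macaulay over $K$; 4. $r=1$, or $r\ge 2$ and $\lambda_2\le t$. -/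

import Mathlib

/-- A finite abstract simplicial complex: a finite, non-empty collection of finite sets that is
closed under taking subsets. The empty set is a face, so the smallest complex is `{∅}`, and the
vertices are the elements `v` with `{v}` a face. -/
@[ext]
structure FiniteComplex (V : Type*) where
  faces : Set (Finset V)
  finite_faces : faces.Finite
  empty_mem : ∅ ∈ faces
  down_closed : ∀ {σ τ : Finset V}, σ ∈ faces → τ ⊆ σ → τ ∈ faces

namespace FiniteComplex

section Combinatorics

variable {V : Type*}

/-- The complex `⟨𝓕⟩` of all subsets of members of a finite non-empty collection `𝓕`. -/
def generate (𝓕 : Set (Finset V)) (hfin : 𝓕.Finite) (hne : 𝓕.Nonempty) : FiniteComplex V where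
  faces := {σ | ∃ F ∈ 𝓕, σ ⊆ F}
  finite_faces := by
    have h : {σ : Finset V | ∃ F ∈ 𝓕, σ ⊆ F} = ⋃ F ∈ 𝓕, (F.powerset : Set (Finset V)) := by
      ext σ
      simp
    rw [h]
    exact hfin.biUnion fun F _ => F.powerset.finite_toSet
  empty_mem := by
    obtain ⟨F, hF⟩ := hne
    exact ⟨F, hF, Finset.empty_subset F⟩
  down_closed := by
    rintro σ τ ⟨F, hF, hσ⟩ hτ
    exact ⟨F, hF, hτ.trans hσ⟩

/-- Facets: the faces that are maximal with respect to inclusion. -/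
def facets (Δ : FiniteComplex V) : Set (Finset V) := {F | Maximal (· ∈ Δ.faces) F}

/-- The dimension of `Δ`: the largest cardinality of a face, minus one. -/
noncomputable def dim (Δ : FiniteComplex V) : ℤ :=
  ((Δ.finite_faces.toFinset.sup Finset.card : ℕ) : ℤ) - 1

/-- `Δ` is pure: all facets have the same dimension. -/
def IsPure (Δ : FiniteComplex V) : Prop :=
  ∀ F ∈ Δ.facets, ∀ G ∈ Δ.facets, F.card = G.card

/-- `Δ` is a simplex `⟨F⟩`; here `F = ∅`, that is `Δ = {∅}`, is allowed. -/
def IsSimplex (Δ : FiniteComplex V) : Prop := ∃ F : Finset V, Δ.faces = {σ | σ ⊆ F}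

/-- The deletion of a vertex `x`: all faces that do not contain `x`. -/
def del (Δ : FiniteComplex V) (x : V) : FiniteComplex V where
  faces := {σ | σ ∈ Δ.faces ∧ x ∉ σ}
  finite_faces := Δ.finite_faces.subset fun _ h => h.1
  empty_mem := ⟨Δ.empty_mem, Finset.notMem_empty x⟩
  down_closed := fun h hτ => ⟨Δ.down_closed h.1 hτ, fun hx => h.2 (hτ hx)⟩

/-- `Δ` is shellable: it is pure and its facets can be ordered `F 0, …, F (m - 1)` such that for
every `i > 0` the complex `⟨F 0, …, F (i - 1)⟩ ∩ ⟨F i⟩` is generated by a non-empty set of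
maximal proper faces of `F i`. -/
def IsShellable (Δ : FiniteComplex V) : Prop :=
  Δ.IsPure ∧ ∃ (m : ℕ) (F : Fin m → Finset V), Function.Injective F ∧ Set.range F = Δ.facets ∧
    ∀ i : Fin m, 0 < (i : ℕ) → ∃ S : Set (Finset V), S.Nonempty ∧ (∀ G ∈ S, G ⋖ F i) ∧
      {σ | (∃ j < i, σ ⊆ F j) ∧ σ ⊆ F i} = {σ | ∃ G ∈ S, σ ⊆ G}

variable [DecidableEq V]

/-- The link of a face `σ`: all faces `τ` disjoint from `σ` with `τ ∪ σ` a face. -/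
def link (Δ : FiniteComplex V) (σ : Finset V) (hσ : σ ∈ Δ.faces) : FiniteComplex V where
  faces := {τ | τ ∈ Δ.faces ∧ Disjoint τ σ ∧ τ ∪ σ ∈ Δ.faces}
  finite_faces := Δ.finite_faces.subset fun _ h => h.1
  empty_mem := ⟨Δ.empty_mem, Finset.disjoint_empty_left σ, by simpa using hσ⟩
  down_closed := fun h hτ =>
    ⟨Δ.down_closed h.1 hτ, Finset.disjoint_of_subset_left hτ h.2.1,
      Δ.down_closed h.2.2 (Finset.union_subset_union_left hτ)⟩

/-- Vertex decomposability: `Δ` is a simplex (possibly `{∅}`), or there is a shedding vertex `x`,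
that is a vertex such that every facet of the deletion of `x` is a facet of `Δ`, whose link and
deletion are both vertex decomposable. -/
inductive IsVertexDecomposable : FiniteComplex V → Prop
  | simplex (Δ : FiniteComplex V) (h : Δ.IsSimplex) : IsVertexDecomposable Δ
  | shed (Δ : FiniteComplex V) (x : V) (hx : {x} ∈ Δ.faces) (hshed : (Δ.del x).facets ⊆ Δ.facets)
      (hlink : IsVertexDecomposable (Δ.link {x} hx)) (hdel : IsVertexDecomposable (Δ.del x)) :
      IsVertexDecomposable Δ

end Combinatorics

section Homology

/-- The quotient `Z / B` for submodules `B ⊆ Z` of a module (in general `Z / (Z ∩ B)`). -/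
abbrev SubQuotient {R M : Type*} [Ring R] [AddCommGroup M] [Module R M] (Z B : Submodule R M) :
    Type _ :=
  Z ⧸ B.submoduleOf Z

universe u v

variable (K : Type u) [Field K] {V : Type v} [LinearOrder V]

/-- The simplicial boundary map: a set `σ = {v₀ < ⋯ < vₙ}` is sent to
`∑ j, (-1) ^ j • (σ \ {vⱼ})`. A singleton is sent to the empty set (augmentation), and the empty
set to `0`. -/
noncomputable def boundary : (Finset V →₀ K) →ₗ[K] (Finset V →₀ K) :=
  Finsupp.lift (Finset V →₀ K) K (Finset V) fun σ =>
    ∑ v ∈ σ, Finsupp.single (σ.erase v) ((-1) ^ (σ.filter (· < v)).card)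

theorem boundary_single (σ : Finset V) (c : K) :
    boundary K (Finsupp.single σ c) =
      ∑ v ∈ σ, Finsupp.single (σ.erase v) (c * (-1) ^ (σ.filter (· < v)).card) := by
  simp [boundary, Finset.smul_sum]

variable (Δ : FiniteComplex V)

/-- The augmented simplicial chains of degree `i`: combinations of faces of dimension `i`,
with the empty face in degree `-1`. -/
noncomputable def chains (i : ℤ) : Submodule K (Finset V →₀ K) :=
  Finsupp.supported K K {σ | σ ∈ Δ.faces ∧ (σ.card : ℤ) - 1 = i}

/-- The cycles of degree `i`. -/
noncomputable def cycles (i : ℤ) : Submodule K (Finset V →₀ K) :=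
  Δ.chains K i ⊓ LinearMap.ker (boundary K)

/-- The boundaries of degree `i`. -/
noncomputable def boundaries (i : ℤ) : Submodule K (Finset V →₀ K) :=
  (Δ.chains K (i + 1)).map (boundary K)

/-- The boundary map squares to zero. -/
theorem boundary_boundary (x : Finset V →₀ K) : boundary K (boundary K x) = 0 := by
  induction x using Finsupp.induction_linear with
  | zero => simp
  | add f g hf hg => simp [hf, hg]
  | single σ c =>
    rw [boundary_single, map_sum]
    simp_rw [boundary_single]
    rw [Finset.sum_sigma']
    refine Finset.sum_involution (fun p _ => ⟨p.2, p.1⟩) ?_ ?_ ?_ ?_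
    · rintro ⟨v, w⟩ h
      simp only [Finset.mem_sigma, Finset.mem_erase] at h
      obtain ⟨hv, hwv, hw⟩ := h
      have key : ∀ a b : V, a ∈ σ → a < b →
          (σ.filter (· < b)).card = ((σ.erase a).filter (· < b)).card + 1 ∧
          ((σ.erase b).filter (· < a)).card = (σ.filter (· < a)).card := by
        intro a b ha hab
        constructor
        · rw [Finset.filter_erase, Finset.card_erase_add_one]
          simp [ha, hab]
        · rw [Finset.filter_erase, Finset.erase_eq_of_notMem]
          simp [hab.le]
      have he : (σ.erase w).erase v = (σ.erase v).erase w := Finset.erase_right_comm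
      simp only [he, ← Finsupp.single_add]
      rw [Finsupp.single_eq_zero]
      rcases lt_or_gt_of_ne hwv with h | h
      · obtain ⟨h1, h2⟩ := key w v hw h
        rw [h1, h2]
        ring
      · obtain ⟨h1, h2⟩ := key v w hv h
        rw [h1, h2]
        ring
    · rintro ⟨v, w⟩ h _ heq
      simp only [Finset.mem_sigma, Finset.mem_erase] at h
      exact h.2.1 (congrArg Sigma.fst heq)
    · rintro ⟨v, w⟩ h
      simp only [Finset.mem_sigma, Finset.mem_erase] at h ⊢
      exact ⟨h.2.2, h.2.1.symm, h.1⟩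
    · rintro ⟨v, w⟩ _
      rfl

/-- Boundaries are cycles. -/
theorem boundaries_le_cycles (i : ℤ) : Δ.boundaries K i ≤ Δ.cycles K i := by
  rw [boundaries, Submodule.map_le_iff_le_comap, chains, Finsupp.supported_eq_span_single,
    Submodule.span_le]
  rintro _ ⟨σ, ⟨hσ, hc⟩, rfl⟩
  refine ⟨?_, boundary_boundary K _⟩
  rw [boundary_single]
  refine Submodule.sum_mem _ fun v hv => Finsupp.single_mem_supported K _ ⟨?_, ?_⟩
  · exact Δ.down_closed hσ (Finset.erase_subset v σ)
  · have := Finset.card_erase_add_one hv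
    omega

/-- The reduced simplicial homology of `Δ` in degree `i` with coefficients in `K`. -/
abbrev ReducedHomology (i : ℤ) : Type (max u v) :=
  SubQuotient (Δ.cycles K i) (Δ.boundaries K i)

/-- `Δ` is Cohen–Macaulay over `K` (Reisner's criterion): the reduced homology of the link of every
face, the empty face included, vanishes below the dimension of that link. -/
def IsCohenMacaulay : Prop :=
  ∀ (σ : Finset V) (hσ : σ ∈ Δ.faces) (i : ℤ), i < (Δ.link σ hσ).dim →
    Subsingleton ((Δ.link σ hσ).ReducedHomology K i)

end Homology

end FiniteComplex

/-- The entry of the cell in row `i` and column `j` (both counted from `0`, row `0` on top) of the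
filling of `μ`: with `r` rows, row `i` is filled from left to right with
`(r - 1 - i) * t + 1, (r - 1 - i) * t + 2, …`. The number of rows is `μ.colLen 0`. -/
def youngEntry (t : ℕ) (μ : YoungDiagram) (i j : ℕ) : ℕ := (μ.colLen 0 - 1 - i) * t + (j + 1)

/-- The sets `{a₁ < a₂ < ⋯}` with one entry `aⱼ` from each column of `μ`; the number of columns is
`μ.rowLen 0`. -/
def youngFacets (t : ℕ) (μ : YoungDiagram) : Set (Finset ℕ) :=
  {F | ∃ a : Fin (μ.rowLen 0) → ℕ, StrictMono a ∧
    (∀ j : Fin (μ.rowLen 0), ∃ i : ℕ, (i, (j : ℕ)) ∈ μ ∧ a j = youngEntry t μ i j) ∧ F = Finset.univ.image a}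

theorem youngFacets_finite (t : ℕ) (μ : YoungDiagram) : (youngFacets t μ).Finite := by
  refine (((μ.cells.image fun c => youngEntry t μ c.1 c.2).powerset).finite_toSet).subset ?_
  rintro _ ⟨a, -, ha, rfl⟩
  simp only [Finset.coe_powerset, Set.mem_preimage, Set.mem_powerset_iff, Finset.coe_subset]
  intro x hx
  obtain ⟨j, -, rfl⟩ := Finset.mem_image.1 hx
  obtain ⟨i, hi, h⟩ := ha j
  exact Finset.mem_image.2 ⟨(i, j), hi, h.symm⟩

theorem youngFacets_nonempty (t : ℕ) (μ : YoungDiagram) : (youngFacets t μ).Nonempty := by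
  refine ⟨_, fun j => youngEntry t μ 0 j, ?_, fun j => ⟨0, ?_, rfl⟩, rfl⟩
  · intro j k h
    simpa [youngEntry] using h
  · exact YoungDiagram.mem_iff_lt_rowLen.2 j.2

/-- The `t`-Young complex of the Young diagram `μ`. -/
def youngComplex (t : ℕ) (μ : YoungDiagram) : FiniteComplex ℕ :=
  FiniteComplex.generate (youngFacets t μ) (youngFacets_finite t μ) (youngFacets_nonempty t μ)

/-! The four conditions are linked in a cycle. A vertex decomposable complex is shelled by listing
the facets of the deletion of a shedding vertex `x`, then `x` joined to the facets of its link;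
Young complexes are pure because every generator has λ₁ elements. A shelling builds each link by
attaching simplices F along the faces that do not contain some R ⊆ F. These form the boundary of F
if R = F, and otherwise a cone with any apex in F \ R, so homology below the top dimension stays
zero over every field (`AcyclicBelow.union_powerset`).

Let r be the number of rows. If λ₂ > t, the top row and the second row continued by the end of the
top row are facets meeting in a face S with λ₁ - t elements. A facet containing S has its remaining
elements all at most (r-1)t or all above it (`youngFacet_separated`), and both cases occur. So the
link of S is disconnected, of dimension t - 1 ≥ 1, and the complex is not Cohen–Macaulay.

If λ₂ ≤ t, describe an entry by its column and its level, that is its row counted from the bottom.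
Entries chosen column by column increase strictly exactly when their levels increase weakly, so
facets are graphs of weakly increasing functions between monotone bounds. This class of complexes is
closed under deletion and link of the highest vertex in the first column with a choice, so induction
applies (`isVertexDecomposable_of_selections`). -/

namespace FiniteComplex

/-! ### Shellings and restrictions. -/

section Shelling

variable {V : Type*}

theorem exists_facet_superset (Δ : FiniteComplex V) {σ : Finset V} (hσ : σ ∈ Δ.faces) :
    ∃ F ∈ Δ.facets, σ ⊆ F := by
  obtain ⟨F, hle, hF⟩ := Δ.finite_faces.exists_le_maximal hσ
  exact ⟨F, hF, hle⟩

variable [DecidableEq V]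

/-- A list of finite sets such that, for each member `F`, the subsets of `F` that are contained in
an earlier member are those that do not contain a certain set `R ⊆ F`, the restriction of `F`. -/
def IsShellingList (l : List (Finset V)) : Prop :=
  ∀ (i : ℕ) (hi : i < l.length), ∃ R ⊆ l[i], ∀ σ ⊆ l[i],
    (∃ G ∈ l.take i, σ ⊆ G) ↔ ¬ R ⊆ σ

/-- The shedding step, with `l₁` from the deletion and `l₂` from the link. A subset of `insert x H`
avoiding `x` is already covered by `hcov`; one containing `x` can be covered only from the second
list, where `x` cancels. Hence the restriction of `H` just gains `x`. -/
theorem IsShellingList.append_map_insert {l₁ l₂ : List (Finset V)} {x : V}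
    (h₁ : IsShellingList l₁) (h₂ : IsShellingList l₂) (hx₁ : ∀ G ∈ l₁, x ∉ G)
    (hx₂ : ∀ H ∈ l₂, x ∉ H) (hcov : ∀ H ∈ l₂, ∃ G ∈ l₁, H ⊆ G) :
    IsShellingList (l₁ ++ l₂.map (insert x)) := by
  intro i hi
  by_cases hlt : i < l₁.length
  · obtain ⟨R, hR, h⟩ := h₁ i hlt
    rw [List.getElem_append_left hlt, List.take_append_of_le_length hlt.le]
    exact ⟨R, hR, h⟩
  · obtain ⟨k, rfl⟩ := Nat.exists_eq_add_of_le (not_lt.1 hlt)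
    have hk : k < l₂.length := by simpa using hi
    obtain ⟨R, hR, h⟩ := h₂ k hk
    have hget : (l₁ ++ l₂.map (insert x))[l₁.length + k] = insert x l₂[k] := by simp
    have htake : (l₁ ++ l₂.map (insert x)).take (l₁.length + k) =
        l₁ ++ (l₂.take k).map (insert x) := by simp [List.take_append]
    have hxk := hx₂ _ (List.getElem_mem hk)
    rw [hget, htake]
    refine ⟨insert x R, Finset.insert_subset_insert x hR, fun σ hσ => ?_⟩
    by_cases hxσ : x ∈ σ
    · have hxR : x ∉ R := fun hxR => hxk (hR hxR)
      have h' := h (σ.erase x) (Finset.subset_insert_iff.1 hσ)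
      rw [Finset.subset_erase, and_iff_left hxR] at h'
      rw [Finset.insert_subset_iff, and_iff_right hxσ, ← h']
      constructor
      · rintro ⟨G, hG, hσG⟩
        rcases List.mem_append.1 hG with hG | hG
        · exact absurd (hσG hxσ) (hx₁ G hG)
        · obtain ⟨H, hH, rfl⟩ := List.mem_map.1 hG
          exact ⟨H, hH, Finset.subset_insert_iff.1 hσG⟩
      · rintro ⟨H, hH, hσH⟩
        exact ⟨insert x H, List.mem_append_right _ (List.mem_map.2 ⟨H, hH, rfl⟩),
          Finset.subset_insert_iff.2 hσH⟩
    · obtain ⟨G, hG, hkG⟩ := hcov _ (List.getElem_mem hk)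
      exact iff_of_true ⟨G, List.mem_append_left _ hG,
        ((Finset.subset_insert_iff_of_notMem hxσ).1 hσ).trans hkG⟩
        fun hh => hxσ (hh (Finset.mem_insert_self x R))

theorem mem_facets_link_singleton {Δ : FiniteComplex V} {x : V} {hx : {x} ∈ Δ.faces}
    {H : Finset V} : H ∈ (Δ.link {x} hx).facets ↔ x ∉ H ∧ insert x H ∈ Δ.facets := by
  have hmem : ∀ τ, τ ∈ (Δ.link {x} hx).faces ↔ x ∉ τ ∧ insert x τ ∈ Δ.faces := by
    intro τ
    simp only [link, Set.mem_ofPred_eq, Finset.disjoint_singleton_right, Finset.union_comm τ,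
      ← Finset.insert_eq]
    exact ⟨fun h => h.2, fun h => ⟨Δ.down_closed h.2 (Finset.subset_insert x τ), h⟩⟩
  simp only [facets, Set.mem_ofPred_eq]
  constructor
  · rintro ⟨hH, hmax⟩
    rw [hmem] at hH
    refine ⟨hH.1, hH.2, fun G hG hHG => ?_⟩
    have hxG : x ∈ G := hHG (Finset.mem_insert_self x H)
    have h := @hmax (G.erase x)
      ((hmem _).2 ⟨Finset.notMem_erase x G, by rwa [Finset.insert_erase hxG]⟩)
      (Finset.subset_erase.2 ⟨(Finset.subset_insert x H).trans hHG, hH.1⟩)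
    exact Finset.subset_insert_iff.2 h
  · rintro ⟨hxH, hH, hmax⟩
    refine ⟨(hmem _).2 ⟨hxH, hH⟩, fun G hG hHG => ?_⟩
    have h := hmax ((hmem _).1 hG).2 (Finset.insert_subset_insert x hHG)
    exact (Finset.subset_insert_iff_of_notMem ((hmem _).1 hG).1).1
      ((Finset.subset_insert x G).trans h)

/-- Purity is left out so that the induction need not pass it to links and deletions. -/
theorem IsVertexDecomposable.exists_isShellingList {Δ : FiniteComplex V}
    (h : Δ.IsVertexDecomposable) :
    ∃ l : List (Finset V), (∀ F, F ∈ l ↔ F ∈ Δ.facets) ∧ IsShellingList l := by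
  induction h with
  | simplex Δ h =>
    obtain ⟨F, hF⟩ := h
    refine ⟨[F], fun G => ?_, fun i hi => ?_⟩
    · simp only [facets, hF, Set.mem_ofPred_eq, List.mem_singleton]
      constructor
      · rintro rfl
        exact ⟨Finset.Subset.refl _, fun H hH _ => hH⟩
      · rintro ⟨hG, hmax⟩
        exact Finset.Subset.antisymm hG (hmax (Finset.Subset.refl F) hG)
    · obtain rfl : i = 0 := by simpa using hi
      exact ⟨∅, Finset.empty_subset _, by simp⟩
  | shed Δ x hx hshed _ _ ihlink ihdel =>
    obtain ⟨l₂, hl₂, h₂⟩ := ihlink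
    obtain ⟨l₁, hl₁, h₁⟩ := ihdel
    refine ⟨l₁ ++ l₂.map (insert x), fun F => ?_, h₁.append_map_insert h₂ ?_ ?_ ?_⟩
    · simp only [List.mem_append, List.mem_map, hl₁, hl₂, mem_facets_link_singleton]
      constructor
      · rintro (hF | ⟨H, ⟨-, hH⟩, rfl⟩)
        · exact hshed hF
        · exact hH
      · intro hF
        by_cases hxF : x ∈ F
        · exact Or.inr ⟨F.erase x, ⟨Finset.notMem_erase x F, by rwa [Finset.insert_erase hxF]⟩,
            Finset.insert_erase hxF⟩
        · exact Or.inl ⟨⟨hF.1, hxF⟩, fun G hG hFG => hF.2 hG.1 hFG⟩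
    · intro G hG
      exact ((hl₁ G).1 hG).1.2
    · intro H hH
      exact (mem_facets_link_singleton.1 ((hl₂ H).1 hH)).1
    · intro H hH
      obtain ⟨hxH, hH⟩ := mem_facets_link_singleton.1 ((hl₂ H).1 hH)
      obtain ⟨G, hG, hHG⟩ := (Δ.del x).exists_facet_superset (σ := H)
        ⟨Δ.down_closed hH.1 (Finset.subset_insert x H), hxH⟩
      exact ⟨G, (hl₁ G).2 hG, hHG⟩

/-- A pure vertex decomposable complex is shellable. -/
theorem IsVertexDecomposable.isShellable {Δ : FiniteComplex V} (h : Δ.IsVertexDecomposable)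
    (hpure : Δ.IsPure) : Δ.IsShellable := by
  obtain ⟨l, hl, hs⟩ := h.exists_isShellingList
  have key : ∀ i : Fin l.length, ∃ R ⊆ l.get i, ∀ σ ⊆ l.get i,
      (∃ j < i, σ ⊆ l.get j) ↔ ¬ R ⊆ σ := by
    intro i
    obtain ⟨R, hR, h⟩ := hs i i.2
    refine ⟨R, hR, fun σ hσ => (h σ hσ).symm.trans ?_ |>.symm⟩
    constructor
    · rintro ⟨G, hG, hσG⟩
      obtain ⟨j, hj, rfl⟩ := List.mem_take_iff_getElem.1 hG
      exact ⟨⟨j, by omega⟩, by simpa [Fin.lt_def] using (by omega : j < i), hσG⟩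
    · rintro ⟨j, hj, hσj⟩
      exact ⟨l.get j, List.mem_take_iff_getElem.2 ⟨j, by simpa using hj, rfl⟩, hσj⟩
  -- Facets do not repeat: each contains its own restriction, so no earlier one covers it.
  have hne : ∀ i j : Fin l.length, j < i → l.get i ≠ l.get j := by
    intro i j hij heq
    obtain ⟨R, hR, h⟩ := key i
    exact (h _ (Finset.Subset.refl _)).1 ⟨j, hij, heq.subset⟩ hR
  refine ⟨hpure, l.length, l.get, fun i j hij => ?_, ?_, fun i hi => ?_⟩
  · rcases lt_trichotomy i j with h | h | h
    · exact absurd hij.symm (hne j i h)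
    · exact h
    · exact absurd hij (hne i j h)
  · ext F
    rw [← hl, List.mem_iff_get, Set.mem_range]
  · obtain ⟨R, hR, h⟩ := key i
    -- Not containing `R` means avoiding some `v ∈ R`. The restriction is non-empty because `∅` lies
    -- in an earlier facet.
    refine ⟨{G | ∃ v ∈ R, G = (l.get i).erase v}, ?_, ?_, ?_⟩
    · have h0 := (h ∅ (Finset.empty_subset _)).1
        ⟨⟨0, by omega⟩, hi, Finset.empty_subset _⟩
      obtain ⟨v, hv, -⟩ := Finset.not_subset.1 h0
      exact ⟨_, v, hv, rfl⟩
    · rintro _ ⟨v, hv, rfl⟩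
      exact Finset.erase_covBy (hR hv)
    · ext σ
      constructor
      · rintro ⟨hold, hσ⟩
        obtain ⟨v, hv, hvσ⟩ := Finset.not_subset.1 ((h σ hσ).1 hold)
        exact ⟨_, ⟨v, hv, rfl⟩, Finset.subset_erase.2 ⟨hσ, hvσ⟩⟩
      · rintro ⟨_, ⟨v, hv, rfl⟩, hσ⟩
        obtain ⟨hσ, hvσ⟩ := Finset.subset_erase.1 hσ
        exact ⟨(h σ hσ).2 fun hRσ => hvσ (hRσ hv), hσ⟩

/-- In a shelling each facet `F i` has a restriction. -/
theorem exists_restriction {m : ℕ} {F : Fin m → Finset V}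
    (h : ∀ i : Fin m, 0 < (i : ℕ) → ∃ S : Set (Finset V), S.Nonempty ∧ (∀ G ∈ S, G ⋖ F i) ∧
      {σ | (∃ j < i, σ ⊆ F j) ∧ σ ⊆ F i} = {σ | ∃ G ∈ S, σ ⊆ G}) (i : Fin m) :
    ∃ R ⊆ F i, ∀ σ ⊆ F i, (∃ j < i, σ ⊆ F j) ↔ ¬ R ⊆ σ := by
  classical
  rcases Nat.eq_zero_or_pos (i : ℕ) with hi | hi
  · refine ⟨∅, Finset.empty_subset _, fun σ _ => iff_of_false ?_ (by simp)⟩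
    rintro ⟨j, hj, -⟩
    rw [Fin.lt_def] at hj
    omega
  · obtain ⟨S, -, hS, heq⟩ := h i hi
    -- The restriction collects the vertices opposite to the generating maximal proper faces.
    refine ⟨(F i).filter fun v => (F i).erase v ∈ S, Finset.filter_subset _ _, fun σ hσ => ?_⟩
    have h1 : (∃ j < i, σ ⊆ F j) ↔ ∃ G ∈ S, σ ⊆ G := by
      rw [← and_iff_left (a := ∃ j < i, σ ⊆ F j) hσ]
      exact Set.ext_iff.1 heq σ
    rw [h1, Finset.not_subset]
    constructor
    · rintro ⟨G, hG, hσG⟩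
      obtain ⟨v, hv, rfl⟩ := Finset.covBy_iff_exists_erase.1 (hS G hG)
      exact ⟨v, Finset.mem_filter.2 ⟨hv, hG⟩, (Finset.subset_erase.1 hσG).2⟩
    · rintro ⟨v, hv, hvσ⟩
      exact ⟨_, (Finset.mem_filter.1 hv).2, Finset.subset_erase.2 ⟨hσ, hvσ⟩⟩

end Shelling

end FiniteComplex

namespace FiniteComplex

/-! ### Homology of shellable and of disconnected complexes. -/

section Acyclicity

universe u v

variable (K : Type u) [Field K] {V : Type v}

variable {K} in
theorem mem_supported_of_forall {A B : Set (Finset V)} {x : Finset V →₀ K}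
    (hx : x ∈ Finsupp.supported K K A) (h : ∀ σ ∈ A, σ ∈ B) : x ∈ Finsupp.supported K K B :=
  Finsupp.supported_mono h hx

variable [LinearOrder V]

/-- The cone operator with apex `v`: a set `σ` that does not contain `v` is sent to
`± insert v σ`, and the other sets to `0`. -/
noncomputable def cone (v : V) : (Finset V →₀ K) →ₗ[K] (Finset V →₀ K) :=
  Finsupp.lift (Finset V →₀ K) K (Finset V) fun σ =>
    if v ∈ σ then 0 else Finsupp.single (insert v σ) ((-1) ^ (σ.filter (· < v)).card)

theorem cone_single_of_mem {v : V} {σ : Finset V} (h : v ∈ σ) (c : K) :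
    cone K v (Finsupp.single σ c) = 0 := by
  simp [cone, h]

theorem cone_single_of_notMem {v : V} {σ : Finset V} (h : v ∉ σ) (c : K) :
    cone K v (Finsupp.single σ c) =
      Finsupp.single (insert v σ) (c * (-1) ^ (σ.filter (· < v)).card) := by
  simp [cone, h]

/-- The cone operator is a contracting homotopy of the augmented chains of the full simplex. -/
theorem boundary_cone_add_cone_boundary (v : V) (x : Finset V →₀ K) :
    boundary K (cone K v x) + cone K v (boundary K x) = x := by
  induction x using Finsupp.induction_linear with
  | zero => simp
  | add f g hf hg =>
    simp only [map_add]
    rw [add_add_add_comm, hf, hg]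
  | single σ c =>
    have hsq : ∀ n : ℕ, c * (-1 : K) ^ n * (-1) ^ n = c := fun n => by
      rw [mul_assoc, ← mul_pow]; simp
    by_cases hv : v ∈ σ
    · rw [cone_single_of_mem K hv, map_zero, zero_add, boundary_single, map_sum,
        Finset.sum_eq_single_of_mem v hv]
      · rw [cone_single_of_notMem K (Finset.notMem_erase v σ), Finset.insert_erase hv,
          Finset.filter_erase, Finset.erase_eq_of_notMem (by simp), hsq]
      · intro w _ hwv
        exact cone_single_of_mem K (Finset.mem_erase.2 ⟨hwv.symm, hv⟩) _
    · rw [cone_single_of_notMem K hv, boundary_single, Finset.sum_insert hv,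
        Finset.erase_insert hv, Finset.filter_insert, if_neg (lt_irrefl v), hsq, boundary_single,
        map_sum, add_assoc, ← Finset.sum_add_distrib, Finset.sum_eq_zero, add_zero]
      -- The terms erasing `w ≠ v` cancel: if `w < v`, erasing `w` lowers the sign exponent of `v`
      -- by one; if `v < w`, inserting `v` raises that of `w`.
      intro w hw
      have hwv : w ≠ v := fun h => hv (h ▸ hw)
      rw [cone_single_of_notMem K (fun h => hv (Finset.mem_of_mem_erase h)),
        Finset.erase_insert_of_ne hwv.symm, ← Finsupp.single_add, Finsupp.single_eq_zero,
        Finset.filter_insert, Finset.filter_erase]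
      rcases lt_or_gt_of_ne hwv with h | h
      · have h1 := Finset.card_erase_add_one (Finset.mem_filter.2 ⟨hw, h⟩ : w ∈ σ.filter (· < v))
        rw [if_neg h.not_gt, ← h1]
        ring
      · rw [if_pos h, Finset.card_insert_of_notMem (by simp [hv]),
          Finset.erase_eq_of_notMem (by simp [h.le])]
        ring

variable {K}

theorem boundary_mem_supported {A B : Set (Finset V)} {x : Finset V →₀ K}
    (hx : x ∈ Finsupp.supported K K A) (h : ∀ σ ∈ A, ∀ v ∈ σ, σ.erase v ∈ B) :
    boundary K x ∈ Finsupp.supported K K B := by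
  suffices Finsupp.supported K K A ≤ (Finsupp.supported K K B).comap (boundary K) from this hx
  rw [Finsupp.supported_eq_span_single, Submodule.span_le]
  rintro _ ⟨σ, hσ, rfl⟩
  rw [SetLike.mem_coe, Submodule.mem_comap, boundary_single]
  exact Submodule.sum_mem _ fun v hv => Finsupp.single_mem_supported K _ (h σ hσ v hv)

theorem cone_mem_supported {A B : Set (Finset V)} {v : V} {x : Finset V →₀ K}
    (hx : x ∈ Finsupp.supported K K A) (h : ∀ σ ∈ A, v ∉ σ → insert v σ ∈ B) :
    cone K v x ∈ Finsupp.supported K K B := by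
  suffices Finsupp.supported K K A ≤ (Finsupp.supported K K B).comap (cone K v) from this hx
  rw [Finsupp.supported_eq_span_single, Submodule.span_le]
  rintro _ ⟨σ, hσ, rfl⟩
  rw [SetLike.mem_coe, Submodule.mem_comap]
  by_cases hv : v ∈ σ
  · rw [cone_single_of_mem K hv]
    exact Submodule.zero_mem _
  · rw [cone_single_of_notMem K hv]
    exact Finsupp.single_mem_supported K _ (h σ hσ hv)

variable (K) in
/-- Every cycle of a collection `A` of finite sets that is supported on sets with fewer than `d`
elements is a boundary. -/
def AcyclicBelow (A : Set (Finset V)) (d : ℕ) : Prop :=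
  ∀ c < d, ∀ z ∈ Finsupp.supported K K {σ | σ ∈ A ∧ σ.card = c}, boundary K z = 0 →
    ∃ y ∈ Finsupp.supported K K {σ | σ ∈ A ∧ σ.card = c + 1}, boundary K y = z

/-- Attaching a simplex `F` along the faces that do not contain `R ⊆ F` preserves acyclicity below
the top dimension. -/
theorem AcyclicBelow.union_powerset {A : Set (Finset V)} {F R : Finset V}
    (hA : ∀ σ ∈ A, ∀ τ ⊆ σ, τ ∈ A) (hR : R ⊆ F) (hF : ∀ σ ⊆ F, σ ∈ A ↔ ¬ R ⊆ σ)
    (h : AcyclicBelow K A F.card) : AcyclicBelow K (A ∪ {σ | σ ⊆ F}) F.card := by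
  classical
  intro c hc z hz hz0
  have hmono : Finsupp.supported K K {σ | σ ∈ A ∧ σ.card = c + 1} ≤
      Finsupp.supported K K {σ | σ ∈ A ∪ {σ | σ ⊆ F} ∧ σ.card = c + 1} :=
    Finsupp.supported_mono fun σ hσ => ⟨Or.inl hσ.1, hσ.2⟩
  rcases hR.eq_or_ssubset with rfl | hssub
  -- Here the only new face is `F`, which has more than `c` elements.
  · have hzA : z ∈ Finsupp.supported K K {σ | σ ∈ A ∧ σ.card = c} := by
      refine mem_supported_of_forall hz fun σ hσ => ⟨?_, hσ.2⟩
      rcases hσ.1 with h1 | h1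
      · exact h1
      · refine (hF σ h1).2 fun hRσ => ?_
        have := Finset.card_le_card hRσ
        have := hσ.2
        omega
    obtain ⟨y, hy, hyz⟩ := h c hc z hzA hz0
    exact ⟨y, hmono hy, hyz⟩
  -- The old part of `F` is a cone with apex `v`. Split `z` into an old part `u` and a new part `w`.
  -- Then `∂w = -∂u` lies in that cone, and so does the cone over `∂w`. The homotopy formula for `w`
  -- replaces `z`, up to a boundary, by the cycle `u + cone ∂w` of `A`.
  · obtain ⟨v, hvF, hvR⟩ := Finset.exists_of_ssubset hssub
    set u := z.filter (· ∈ A) with hu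
    set w := z.filter (· ∉ A) with hw
    have huw : u + w = z := Finsupp.filter_add_filter_not z _
    rw [Finsupp.mem_supported] at hz
    have huA : u ∈ Finsupp.supported K K {σ | σ ∈ A ∧ σ.card = c} := by
      rw [Finsupp.mem_supported]
      intro σ hσ
      rw [Finset.mem_coe, hu, Finsupp.support_filter, Finset.mem_filter] at hσ
      exact ⟨hσ.2, (hz hσ.1).2⟩
    have hwF : w ∈ Finsupp.supported K K {σ | σ ⊆ F ∧ σ.card = c} := by
      rw [Finsupp.mem_supported]
      intro σ hσ
      rw [Finset.mem_coe, hw, Finsupp.support_filter, Finset.mem_filter] at hσ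
      exact ⟨(hz hσ.1).1.resolve_left hσ.2, (hz hσ.1).2⟩
    have hbw : boundary K w ∈ Finsupp.supported K K {σ | (σ ∈ A ∧ σ ⊆ F) ∧ σ.card + 1 = c} := by
      have h1 : boundary K w ∈ Finsupp.supported K K {σ | σ ⊆ F ∧ σ.card + 1 = c} :=
        boundary_mem_supported hwF fun σ hσ v hv => ⟨(Finset.erase_subset v σ).trans hσ.1,
          (Finset.card_erase_add_one hv).trans hσ.2⟩
      have h2 : boundary K w ∈ Finsupp.supported K K A := by
        have : boundary K w = - boundary K u := by
          rw [← huw, map_add] at hz0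
          exact (neg_eq_of_add_eq_zero_right hz0).symm
        rw [this]
        exact Submodule.neg_mem _ (boundary_mem_supported huA
          fun σ hσ v _ => hA σ hσ.1 _ (Finset.erase_subset v σ))
      rw [Finsupp.mem_supported] at h1 h2 ⊢
      exact fun σ hσ => ⟨⟨h2 hσ, (h1 hσ).1⟩, (h1 hσ).2⟩
    have hcb : cone K v (boundary K w) ∈ Finsupp.supported K K {σ | σ ∈ A ∧ σ.card = c} := by
      refine cone_mem_supported hbw fun σ hσ hv => ⟨?_, ?_⟩
      · refine (hF _ (Finset.insert_subset hvF hσ.1.2)).2 fun hRσ => ?_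
        exact (hF σ hσ.1.2).1 hσ.1.1 ((Finset.subset_insert_iff_of_notMem hvR).1 hRσ)
      · rw [Finset.card_insert_of_notMem hv, hσ.2]
    have hcw : cone K v w ∈
        Finsupp.supported K K {σ | σ ∈ A ∪ {σ | σ ⊆ F} ∧ σ.card = c + 1} :=
      cone_mem_supported hwF fun σ hσ hv => ⟨Or.inr (Finset.insert_subset hvF hσ.1),
        by rw [Finset.card_insert_of_notMem hv, hσ.2]⟩
    have hhom := boundary_cone_add_cone_boundary K v w
    have hdecomp : u + cone K v (boundary K w) = z - boundary K (cone K v w) := by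
      rw [← huw, ← hhom, hhom]
      nth_rewrite 2 [← hhom]
      abel
    obtain ⟨y, hy, hyz⟩ := h c hc _ (Submodule.add_mem _ huA hcb) (by
      rw [hdecomp, map_sub, hz0, boundary_boundary, sub_zero])
    refine ⟨y + cone K v w, Submodule.add_mem _ (hmono hy) hcw, ?_⟩
    rw [map_add, hyz, hdecomp, sub_add_cancel]

/-- The links of a complex with a shelling are acyclic below their dimension. -/
theorem acyclicBelow_link_of_restrictions {m N : ℕ} {F : Fin m → Finset V}
    (hcard : ∀ i, (F i).card = N)
    (h : ∀ i, ∃ R ⊆ F i, ∀ σ ⊆ F i, (∃ j < i, σ ⊆ F j) ↔ ¬ R ⊆ σ) (σ : Finset V) (n : ℕ) :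
    AcyclicBelow K {τ | Disjoint τ σ ∧ ∃ j : Fin m, (j : ℕ) < n ∧ τ ∪ σ ⊆ F j}
      (N - σ.card) := by
  induction n with
  | zero =>
    intro c _ z hz _
    have hz0 : z = 0 := by
      rw [Finsupp.mem_supported] at hz
      rw [← Finsupp.support_eq_empty, Finset.eq_empty_iff_forall_notMem]
      intro τ hτ
      obtain ⟨⟨-, j, hj, -⟩, -⟩ := hz hτ
      exact absurd hj (Nat.not_lt_zero _)
    exact ⟨0, Submodule.zero_mem _, by rw [map_zero, hz0]⟩
  | succ n ih =>
    -- Only a facet containing `σ` changes the link: it attaches `F n \ σ`, with restriction `R \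
    -- σ`.
    by_cases hn : ∃ hn : n < m, σ ⊆ F ⟨n, hn⟩
    · obtain ⟨hn, hσ⟩ := hn
      obtain ⟨R, hR, hRF⟩ := h ⟨n, hn⟩
      have hd : N - σ.card = (F ⟨n, hn⟩ \ σ).card := by
        rw [Finset.card_sdiff_of_subset hσ, hcard]
      rw [hd] at ih ⊢
      have key := ih.union_powerset (R := R \ σ) ?_ (Finset.sdiff_subset_sdiff hR le_rfl) ?_
      · convert key using 1
        ext τ
        simp only [Set.mem_ofPred_eq, Set.mem_union, Finset.subset_sdiff]
        constructor
        · rintro ⟨hdis, j, hj, hτ⟩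
          rcases (Nat.lt_succ_iff_lt_or_eq).1 hj with hj | hj
          · exact Or.inl ⟨hdis, j, hj, hτ⟩
          · obtain rfl : j = ⟨n, hn⟩ := Fin.ext hj
            exact Or.inr ⟨Finset.union_subset_left hτ, hdis⟩
        · rintro (⟨hdis, j, hj, hτ⟩ | ⟨hτ, hdis⟩)
          · exact ⟨hdis, j, hj.trans (Nat.lt_succ_self n), hτ⟩
          · exact ⟨hdis, ⟨n, hn⟩, Nat.lt_succ_self n, Finset.union_subset hτ hσ⟩
      · rintro τ ⟨hdis, j, hj, hτ⟩ ρ hρ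
        exact ⟨Finset.disjoint_of_subset_left hρ hdis, j, hj,
          (Finset.union_subset_union_left hρ).trans hτ⟩
      · intro τ hτ
        obtain ⟨hτF, hdis⟩ := Finset.subset_sdiff.1 hτ
        have h1 := hRF (τ ∪ σ) (Finset.union_subset hτF hσ)
        rw [sdiff_le_iff, Finset.sup_eq_union, Finset.union_comm, ← h1]
        exact ⟨fun ⟨_, j, hj, hj'⟩ => ⟨j, hj, hj'⟩, fun ⟨j, hj, hj'⟩ => ⟨hdis, j, hj, hj'⟩⟩
    · convert ih using 1
      ext τ
      simp only [Set.mem_ofPred_eq]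
      refine and_congr_right fun _ => exists_congr fun j =>
        ⟨fun ⟨hj, hτ⟩ => ⟨?_, hτ⟩, fun ⟨hj, hτ⟩ => ⟨by omega, hτ⟩⟩
      refine lt_of_le_of_ne (Nat.lt_succ_iff.1 hj) fun hjn => hn ?_
      subst hjn
      exact ⟨j.2, Finset.union_subset_right hτ⟩

theorem subsingleton_reducedHomology_iff {Δ : FiniteComplex V} {i : ℤ} :
    Subsingleton (Δ.ReducedHomology K i) ↔ Δ.cycles K i ≤ Δ.boundaries K i := by
  refine Submodule.Quotient.subsingleton_iff.trans ?_
  rw [Submodule.submoduleOf, Submodule.comap_subtype_eq_top]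

variable (K) in
/-- Shellable complexes are Cohen–Macaulay over every field. -/
theorem IsShellable.isCohenMacaulay {Δ : FiniteComplex V} (h : Δ.IsShellable) :
    Δ.IsCohenMacaulay K := by
  obtain ⟨hpure, m, F, -, hrange, hshell⟩ := h
  intro σ hσ i hi
  have hfacet : ∀ j, F j ∈ Δ.facets := fun j => hrange ▸ Set.mem_range_self j
  obtain ⟨G, hG, -⟩ := Δ.exists_facet_superset hσ
  have hcard : ∀ j, (F j).card = G.card := fun j => hpure _ (hfacet j) _ hG
  have hmem : ∀ τ, τ ∈ (Δ.link σ hσ).faces ↔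
      Disjoint τ σ ∧ ∃ j : Fin m, (j : ℕ) < m ∧ τ ∪ σ ⊆ F j := by
    intro τ
    constructor
    · rintro ⟨-, hdis, hτ⟩
      obtain ⟨H, hH, hτH⟩ := Δ.exists_facet_superset hτ
      rw [← hrange] at hH
      obtain ⟨j, rfl⟩ := hH
      exact ⟨hdis, j, j.2, hτH⟩
    · rintro ⟨hdis, j, -, hj⟩
      have h1 := Δ.down_closed (hfacet j).1 hj
      exact ⟨Δ.down_closed h1 Finset.subset_union_left, hdis, h1⟩
  have hdim : (Δ.link σ hσ).dim ≤ ((G.card - σ.card : ℕ) : ℤ) - 1 := by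
    refine sub_le_sub_right (Nat.cast_le.2 (Finset.sup_le fun τ hτ => ?_)) 1
    obtain ⟨hdis, j, -, hj⟩ := (hmem τ).1 ((Set.Finite.mem_toFinset _).1 hτ)
    have := Finset.card_le_card hj
    rw [Finset.card_union_of_disjoint hdis, hcard] at this
    omega
  rw [subsingleton_reducedHomology_iff]
  rintro z ⟨hz, hz0⟩
  rw [SetLike.mem_coe, LinearMap.mem_ker] at hz0
  have key := acyclicBelow_link_of_restrictions (K := K) hcard (exists_restriction hshell) σ m
  rcases lt_or_ge i (-1) with hi1 | hi1
  · have : z = 0 := by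
      rw [SetLike.mem_coe, chains, Finsupp.mem_supported] at hz
      rw [← Finsupp.support_eq_empty, Finset.eq_empty_iff_forall_notMem]
      intro τ hτ
      have := (hz hτ).2
      omega
    rw [this]
    exact Submodule.zero_mem _
  · obtain ⟨c, hc⟩ := Int.eq_ofNat_of_zero_le (by omega : 0 ≤ i + 1)
    obtain ⟨y, hy, hyz⟩ := key c (by omega) z
      (mem_supported_of_forall hz fun τ hτ => ⟨(hmem τ).1 hτ.1, by have := hτ.2; omega⟩) hz0
    refine ⟨y, mem_supported_of_forall hy fun τ hτ => ⟨(hmem τ).2 hτ.1, ?_⟩, hyz⟩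
    have := hτ.2
    push_cast [this]
    omega

variable (K) in
/-- A complex whose faces all lie on one side of a threshold, with vertices on both sides, has
non-trivial reduced homology in degree `0`. -/
theorem not_subsingleton_reducedHomology_zero {Δ : FiniteComplex V} {p : V → Prop}
    (hsep : ∀ τ ∈ Δ.faces, (∀ w ∈ τ, p w) ∨ ∀ w ∈ τ, ¬ p w) {a b : V}
    (ha : {a} ∈ Δ.faces) (hb : {b} ∈ Δ.faces) (hpa : p a) (hpb : ¬ p b) :
    ¬ Subsingleton (Δ.ReducedHomology K 0) := by
  classical
  rw [subsingleton_reducedHomology_iff]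
  intro hle
  -- This functional adds the coefficients on the side `p`. The two ends of an edge are on the same
  -- side, so it kills boundaries, but it is 1 on the cycle `{a} - {b}`.
  let ε : (Finset V →₀ K) →ₗ[K] K :=
    Finsupp.lift K K (Finset V) fun σ => if ∀ w ∈ σ, p w then 1 else 0
  have hε : ∀ σ (c : K), ε (Finsupp.single σ c) = if ∀ w ∈ σ, p w then c else 0 := by
    intro σ c
    simp [ε]
  have hz : (Finsupp.single {a} 1 - Finsupp.single {b} 1 : Finset V →₀ K) ∈ Δ.cycles K 0 := by
    refine ⟨Submodule.sub_mem _ ?_ ?_, ?_⟩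
    · exact Finsupp.single_mem_supported K _ ⟨ha, by simp⟩
    · exact Finsupp.single_mem_supported K _ ⟨hb, by simp⟩
    · rw [SetLike.mem_coe, LinearMap.mem_ker, map_sub, boundary_single, boundary_single]
      simp [Finset.filter_singleton]
  have hε1 : ε (Finsupp.single {a} 1 - Finsupp.single {b} 1) = 1 := by
    rw [map_sub, hε, hε]
    simp [hpa, hpb]
  have hε0 : Δ.boundaries K 0 ≤ LinearMap.ker ε := by
    rw [boundaries, Submodule.map_le_iff_le_comap, chains, Finsupp.supported_eq_span_single,
      Submodule.span_le]
    rintro _ ⟨σ, ⟨hσ, hc⟩, rfl⟩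
    obtain ⟨x, y, hxy, rfl⟩ : ∃ x y, x < y ∧ σ = {x, y} := by
      obtain ⟨x, y, hne, rfl⟩ := Finset.card_eq_two.1 (by omega : σ.card = 2)
      rcases lt_or_gt_of_ne hne with h | h
      · exact ⟨x, y, h, rfl⟩
      · exact ⟨y, x, h, Finset.pair_comm x y⟩
    have hp : p x ↔ p y := by
      rcases hsep _ hσ with h | h
      · exact iff_of_true (h x (by simp)) (h y (by simp))
      · exact iff_of_false (h x (by simp)) (h y (by simp))
    rw [SetLike.mem_coe, Submodule.mem_comap, LinearMap.mem_ker, boundary_single,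
      Finset.sum_pair hxy.ne, map_add, hε, hε]
    have e1 : ({x, y} : Finset V).erase x = {y} := by
      rw [Finset.erase_insert (by simpa using hxy.ne)]
    have e2 : ({x, y} : Finset V).erase y = {x} := by
      rw [Finset.pair_comm, Finset.erase_insert (by simpa using hxy.ne')]
    have e3 : ({x, y} : Finset V).filter (· < x) = ∅ := by
      simp [Finset.filter_insert, Finset.filter_singleton, hxy.le]
    have e4 : ({x, y} : Finset V).filter (· < y) = {x} := by
      simp [Finset.filter_insert, Finset.filter_singleton, hxy]
    rw [e1, e2, e3, e4]
    by_cases h : p y <;> simp [hp, h]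
  have := hε0 (hle hz)
  rw [LinearMap.mem_ker, hε1] at this
  exact one_ne_zero this

end Acyclicity

end FiniteComplex

namespace FiniteComplex

/-! ### Complexes of monotone selections. -/

section Selections

variable {V : Type*}

/-- `k` is a weakly increasing choice, for each `j ∈ J`, of an integer between `lo j` and
`hi j`. -/
def IsSelection (J : Finset ℕ) (lo hi k : ℕ → ℕ) : Prop :=
  MonotoneOn k (J : Set ℕ) ∧ ∀ j ∈ J, lo j ≤ k j ∧ k j ≤ hi j

theorem mem_facets_of_card_le {Δ : FiniteComplex V} {n : ℕ} (h : ∀ σ ∈ Δ.faces, σ.card ≤ n)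
    {F : Finset V} (hF : F ∈ Δ.faces) (hcard : n ≤ F.card) : F ∈ Δ.facets :=
  ⟨hF, fun _ hG hFG => (Finset.eq_of_subset_of_card_le hFG ((h _ hG).trans hcard)).superset⟩

variable [DecidableEq V]

/-- The complex of graphs of weakly increasing choices between monotone bounds is vertex
decomposable. -/
theorem isVertexDecomposable_of_selections (e : ℕ → ℕ → V) (J : Finset ℕ) (lo hi : ℕ → ℕ)
    (hlo : MonotoneOn lo (J : Set ℕ)) (hhi : MonotoneOn hi (J : Set ℕ))
    (hle : ∀ j ∈ J, lo j ≤ hi j)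
    (hinj : ∀ j ∈ J, ∀ j' ∈ J, ∀ k k', lo j ≤ k → k ≤ hi j → lo j' ≤ k' → k' ≤ hi j' →
      e j k = e j' k' → j = j' ∧ k = k')
    (Δ : FiniteComplex V)
    (hΔ : ∀ σ, σ ∈ Δ.faces ↔ ∃ k, IsSelection J lo hi k ∧ σ ⊆ J.image fun j => e j (k j)) :
    Δ.IsVertexDecomposable := by
  -- The link drops a column and raises `lo`, the deletion lowers `hi`; hence the arbitrary column
  -- set and the varying bounds.
  induction hN : ∑ j ∈ J, (hi j - lo j) using Nat.strong_induction_on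
    generalizing J lo hi Δ with
  | _ N ih =>
  subst hN
  by_cases hall : ∀ j ∈ J, lo j = hi j
  · refine .simplex Δ ⟨J.image fun j => e j (lo j), ?_⟩
    ext σ
    rw [hΔ, Set.mem_ofPred_eq]
    constructor
    · rintro ⟨k, hk, hσ⟩
      have : J.image (fun j => e j (k j)) = J.image fun j => e j (lo j) :=
        Finset.image_congr fun j hj => by
          have h1 := hk.2 j hj
          have h2 := hall j hj
          have : k j = lo j := by omega
          simp only [this]
      rwa [← this]
    · exact fun hσ => ⟨lo, ⟨hlo, fun j hj => ⟨le_rfl, hle j hj⟩⟩, hσ⟩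
  -- All columns before `j₀` are forced. The vertex to shed is the top choice in column `j₀`.
  · obtain ⟨j₀, hj₀, hlt, hmin⟩ : ∃ j₀ ∈ J, lo j₀ < hi j₀ ∧ ∀ j ∈ J, j < j₀ → lo j = hi j := by
      have hne : ∃ j, j ∈ J ∧ lo j ≠ hi j := by
        push Not at hall
        exact hall
      refine ⟨Nat.find hne, (Nat.find_spec hne).1,
        lt_of_le_of_ne (hle _ (Nat.find_spec hne).1) (Nat.find_spec hne).2, fun j hj hjlt => ?_⟩
      by_contra h
      exact Nat.find_min hne hjlt ⟨hj, h⟩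
    have hcard : ∀ k, IsSelection J lo hi k → (J.image fun j => e j (k j)).card = J.card :=
      fun k hk => Finset.card_image_of_injOn fun j hj j' hj' h =>
        (hinj j hj j' hj' _ _ (hk.2 j hj).1 (hk.2 j hj).2 (hk.2 j' hj').1 (hk.2 j' hj').2 h).1
    have hmem : ∀ k, IsSelection J lo hi k →
        (e j₀ (hi j₀) ∈ J.image (fun j => e j (k j)) ↔ k j₀ = hi j₀) := by
      intro k hk
      rw [Finset.mem_image]
      constructor
      · rintro ⟨j, hj, h⟩
        obtain ⟨rfl, h⟩ := hinj j hj j₀ hj₀ _ _ (hk.2 j hj).1 (hk.2 j hj).2 hlt.le le_rfl h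
        exact h
      · exact fun h => ⟨j₀, hj₀, by rw [h]⟩
    -- the top choice in column `j₀`
    have htop : IsSelection J lo hi fun j => if j < j₀ then lo j else hi j := by
      refine ⟨fun i hi' j hj hij => ?_, fun j hj => ?_⟩
      · have h1 := hlo hi' hj hij
        have h2 := hhi hi' hj hij
        have h3 := hle i hi'
        have h4 := hle j hj
        dsimp only
        split_ifs <;> omega
      · have := hle j hj
        dsimp only
        split_ifs <;> omega
    have hx : {e j₀ (hi j₀)} ∈ Δ.faces := by
      rw [hΔ]
      refine ⟨_, htop, Finset.singleton_subset_iff.2 ((hmem _ htop).2 (by simp))⟩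
    -- selections for the deletion
    have hupd : ∀ k, IsSelection J lo (Function.update hi j₀ (hi j₀ - 1)) k ↔
        IsSelection J lo hi k ∧ k j₀ < hi j₀ := by
      intro k
      constructor
      · rintro ⟨hk, hb⟩
        have h0 := hb j₀ hj₀
        rw [Function.update_self] at h0
        refine ⟨⟨hk, fun j hj => ?_⟩, by omega⟩
        by_cases hjj : j = j₀
        · subst hjj
          omega
        · have := hb j hj
          rwa [Function.update_of_ne hjj] at this
      · rintro ⟨⟨hk, hb⟩, h0⟩
        refine ⟨hk, fun j hj => ?_⟩
        by_cases hjj : j = j₀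
        · subst hjj
          have := hb j hj
          rw [Function.update_self]
          omega
        · rw [Function.update_of_ne hjj]
          exact hb j hj
    have hdel : ∀ σ, σ ∈ (Δ.del (e j₀ (hi j₀))).faces ↔
        ∃ k, IsSelection J lo (Function.update hi j₀ (hi j₀ - 1)) k ∧
          σ ⊆ J.image fun j => e j (k j) := by
      intro σ
      simp only [del, Set.mem_ofPred_eq, hΔ, hupd]
      constructor
      · rintro ⟨⟨k, hk, hσ⟩, hxσ⟩
        by_cases hkj : k j₀ = hi j₀
        -- As `σ` avoids the shed vertex, its column is free to drop to `lo j₀`; the forced columns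
        -- before it lie no higher.
        · refine ⟨Function.update k j₀ (lo j₀), ⟨⟨fun i hi' j hj hij => ?_, fun j hj => ?_⟩, ?_⟩,
            fun y hy => ?_⟩
          · have h1 := hk.1 hi' hj hij
            have h2 := hk.2 i hi'
            have h3 := hk.2 j hj
            have h4 := hlo hi' hj hij
            by_cases hi0 : i = j₀ <;> by_cases hj0 : j = j₀
            · rw [hi0, hj0]
            · subst hi0
              rw [Function.update_self, Function.update_of_ne hj0]
              omega
            · subst hj0
              have := hmin i hi' (lt_of_le_of_ne hij hi0)
              rw [Function.update_self, Function.update_of_ne hi0]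
              omega
            · rwa [Function.update_of_ne hj0, Function.update_of_ne hi0]
          · by_cases hj0 : j = j₀
            · subst hj0
              rw [Function.update_self]
              exact ⟨le_rfl, hlt.le⟩
            · rw [Function.update_of_ne hj0]
              exact hk.2 j hj
          · rwa [Function.update_self]
          · obtain ⟨j, hj, rfl⟩ := Finset.mem_image.1 (hσ hy)
            have hj0 : j ≠ j₀ := by
              rintro rfl
              rw [hkj] at hy
              exact hxσ hy
            exact Finset.mem_image.2 ⟨j, hj, by rw [Function.update_of_ne hj0]⟩
        · exact ⟨k, ⟨hk, lt_of_le_of_ne (hk.2 j₀ hj₀).2 hkj⟩, hσ⟩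
      · rintro ⟨k, ⟨hk, hkj⟩, hσ⟩
        exact ⟨⟨k, hk, hσ⟩, fun hxσ => hkj.ne ((hmem k hk).1 (hσ hxσ))⟩
    -- Fixing the value `hi j₀` bounds later columns from below. Earlier ones need no new bound,
    -- since their `hi` is at most `hi j₀`.
    have hlink : ∀ σ, σ ∈ (Δ.link {e j₀ (hi j₀)} hx).faces ↔
        ∃ k, IsSelection (J.erase j₀) (fun j => if j₀ < j then max (lo j) (hi j₀) else lo j) hi k ∧
          σ ⊆ (J.erase j₀).image fun j => e j (k j) := by
      intro σ
      simp only [link, Set.mem_ofPred_eq, hΔ, Finset.disjoint_singleton_right]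
      constructor
      · rintro ⟨-, hxσ, k, hk, hσ⟩
        have hkj : k j₀ = hi j₀ :=
          (hmem k hk).1 (hσ (Finset.mem_union_right _ (Finset.mem_singleton_self _)))
        refine ⟨k, ⟨hk.1.mono (by simp), fun j hj => ?_⟩, fun y hy => ?_⟩
        · have hj := Finset.mem_of_mem_erase hj
          have h1 := hk.2 j hj
          refine ⟨?_, h1.2⟩
          dsimp only
          split_ifs with h
          · have := hk.1 hj₀ hj h.le
            omega
          · exact h1.1
        · obtain ⟨j, hj, rfl⟩ := Finset.mem_image.1 (hσ (Finset.mem_union_left _ hy))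
          refine Finset.mem_image.2 ⟨j, Finset.mem_erase.2 ⟨?_, hj⟩, rfl⟩
          rintro rfl
          rw [hkj] at hy
          exact hxσ hy
      · rintro ⟨k, hk, hσ⟩
        have hb : ∀ j ∈ J, j ≠ j₀ → lo j ≤ k j ∧ k j ≤ hi j ∧ (j₀ < j → hi j₀ ≤ k j) := by
          intro j hj hj0
          have := hk.2 j (Finset.mem_erase.2 ⟨hj0, hj⟩)
          dsimp only at this
          split_ifs at this <;> omega
        have hk' : IsSelection J lo hi (Function.update k j₀ (hi j₀)) := by
          refine ⟨fun i hi' j hj hij => ?_, fun j hj => ?_⟩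
          · by_cases hi0 : i = j₀ <;> by_cases hj0 : j = j₀
            · rw [hi0, hj0]
            · subst hi0
              rw [Function.update_self, Function.update_of_ne hj0]
              exact (hb j hj hj0).2.2 (lt_of_le_of_ne hij (Ne.symm hj0))
            · subst hj0
              rw [Function.update_self, Function.update_of_ne hi0]
              exact (hb i hi' hi0).2.1.trans (hhi hi' hj hij)
            · rw [Function.update_of_ne hj0, Function.update_of_ne hi0]
              exact hk.1 (Finset.mem_coe.2 (Finset.mem_erase.2 ⟨hi0, hi'⟩))
                (Finset.mem_coe.2 (Finset.mem_erase.2 ⟨hj0, hj⟩)) hij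
          · by_cases hj0 : j = j₀
            · subst hj0
              rw [Function.update_self]
              exact ⟨hlt.le, le_rfl⟩
            · rw [Function.update_of_ne hj0]
              exact ⟨(hb j hj hj0).1, (hb j hj hj0).2.1⟩
        have hσ' : σ ⊆ J.image fun j => e j (Function.update k j₀ (hi j₀) j) := by
          intro y hy
          obtain ⟨j, hj, rfl⟩ := Finset.mem_image.1 (hσ hy)
          exact Finset.mem_image.2 ⟨j, Finset.mem_of_mem_erase hj, by
            rw [Function.update_of_ne (Finset.ne_of_mem_erase hj)]⟩
        refine ⟨⟨_, hk', hσ'⟩, fun hxσ => ?_, _, hk', Finset.union_subset hσ'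
          (Finset.singleton_subset_iff.2 ((hmem _ hk').2 (Function.update_self ..)))⟩
        obtain ⟨j, hj, h⟩ := Finset.mem_image.1 (hσ hxσ)
        have hjJ := Finset.mem_of_mem_erase hj
        have hj0 := Finset.ne_of_mem_erase hj
        exact hj0 (hinj j hjJ j₀ hj₀ _ _ (hb j hjJ hj0).1 (hb j hjJ hj0).2.1 hlt.le le_rfl h).1
    refine .shed Δ (e j₀ (hi j₀)) hx (fun F hF => ?_) ?_ ?_
    -- A facet of the deletion is a full graph, so it has the largest cardinality possible in `Δ`.
    · obtain ⟨k, hk, hFk⟩ := (hdel F).1 hF.1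
      have hFeq := (hF.2 ((hdel _).2 ⟨k, hk, Finset.Subset.refl _⟩) hFk).antisymm hFk
      refine mem_facets_of_card_le (n := J.card) (fun σ hσ => ?_) hF.1.1 ?_
      · obtain ⟨k', hk', hσ⟩ := (hΔ σ).1 hσ
        exact (Finset.card_le_card hσ).trans (hcard k' hk').le
      · rw [← hFeq, hcard k ((hupd k).1 hk).1]
    · refine ih _ ?_ (J.erase j₀) _ hi ?_ (hhi.mono (by simp)) ?_ ?_ _ hlink rfl
      · rw [← Finset.add_sum_erase J _ hj₀]
        refine lt_add_of_pos_of_le (by omega) (Finset.sum_le_sum fun j _ => ?_)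
        split_ifs <;> omega
      · intro i hi' j hj hij
        have hi' := Finset.mem_of_mem_erase (Finset.mem_coe.1 hi')
        have hj := Finset.mem_of_mem_erase (Finset.mem_coe.1 hj)
        have := hlo hi' hj hij
        dsimp only
        split_ifs <;> omega
      · intro j hj
        have hj := Finset.mem_of_mem_erase hj
        have h1 := hle j hj
        split_ifs with h
        · have := hhi hj₀ hj h.le
          omega
        · exact h1
      · intro j hj j' hj' k k' h1 h2 h3 h4
        refine hinj j (Finset.mem_of_mem_erase hj) j' (Finset.mem_of_mem_erase hj') k k' ?_ h2 ?_ h4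
        · split_ifs at h1 <;> omega
        · split_ifs at h3 <;> omega
    · have hupd_le : ∀ j, Function.update hi j₀ (hi j₀ - 1) j ≤ hi j := by
        intro j
        by_cases hj0 : j = j₀
        · subst hj0
          rw [Function.update_self]
          omega
        · rw [Function.update_of_ne hj0]
      refine ih _ ?_ J lo _ hlo ?_ ?_ ?_ _ hdel rfl
      · refine Finset.sum_lt_sum (fun j _ => Nat.sub_le_sub_right (hupd_le j) _) ⟨j₀, hj₀, ?_⟩
        rw [Function.update_self]
        omega
      -- The lowered bound is still monotone: for `i` before `j₀`, `hi i = lo i ≤ lo j₀ ≤ hi j₀ -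
      -- 1`.
      · intro i hi' j hj hij
        have h1 := hhi hi' hj hij
        have h2 := hlo hi' hj hij
        by_cases hj0 : j = j₀
        · subst hj0
          by_cases hi0 : i = j
          · rw [hi0]
          · have := hmin i hi' (lt_of_le_of_ne hij hi0)
            rw [Function.update_self, Function.update_of_ne hi0]
            omega
        · rw [Function.update_of_ne hj0]
          exact (hupd_le i).trans h1
      · intro j hj
        have := hle j hj
        by_cases hj0 : j = j₀
        · subst hj0
          rw [Function.update_self]
          omega
        · rwa [Function.update_of_ne hj0]
      · intro j hj j' hj' k k' h1 h2 h3 h4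
        exact hinj j hj j' hj' k k' h1 (h2.trans (hupd_le j)) h3 (h4.trans (hupd_le j'))

end Selections

end FiniteComplex

/-! ### Young complexes: purity and the case λ₂ ≤ t. -/

section YoungComplex

open FiniteComplex

variable {t : ℕ} {μ : YoungDiagram}

theorem youngComplex_isPure (t : ℕ) (μ : YoungDiagram) : (youngComplex t μ).IsPure := by
  have h : ∀ F ∈ (youngComplex t μ).facets, F.card = μ.rowLen 0 := by
    rintro F ⟨⟨G, hG, hFG⟩, hmax⟩
    obtain rfl := (hmax (y := G) ⟨G, hG, Finset.Subset.refl G⟩ hFG).antisymm hFG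
    obtain ⟨a, ha, -, rfl⟩ := hG
    rw [Finset.card_image_of_injective _ ha.injective, Finset.card_fin]
  exact fun F hF G hG => (h F hF).trans (h G hG).symm

theorem lt_colLen_zero {i j : ℕ} (h : (i, j) ∈ μ) : i < μ.colLen 0 :=
  YoungDiagram.mem_iff_lt_colLen.1 (μ.up_left_mem le_rfl (Nat.zero_le j) h)

theorem row_eq_zero {i j : ℕ} (h : (i, j) ∈ μ) (hj : μ.rowLen 1 ≤ j) : i = 0 := by
  by_contra hi
  have := YoungDiagram.mem_iff_lt_rowLen.1
    (μ.up_left_mem (Nat.one_le_iff_ne_zero.2 hi) le_rfl h)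
  omega

/-- If the second row has length at most `t`, the complex is vertex decomposable. -/
theorem youngComplex_isVertexDecomposable (h1 : μ.rowLen 1 ≤ t) :
    (youngComplex t μ).IsVertexDecomposable := by
  have hcol : ∀ j < μ.rowLen 0, 0 < μ.colLen j := fun j hj =>
    YoungDiagram.mem_iff_lt_colLen.1 (YoungDiagram.mem_iff_lt_rowLen.2 hj)
  have hcol0 : ∀ j, μ.colLen j ≤ μ.colLen 0 := fun j => μ.colLen_anti 0 j (Nat.zero_le j)
  have hcol1 : ∀ j, t ≤ j → μ.colLen j ≤ 1 := fun j hj => by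
    by_contra h
    have := YoungDiagram.mem_iff_lt_rowLen.1
      (YoungDiagram.mem_iff_lt_colLen.2 (not_le.1 h) : (1, j) ∈ μ)
    omega
  -- levels in two columns whose entries are out of order
  have hlevel : ∀ j j' k k' : ℕ, μ.colLen 0 - μ.colLen j' ≤ k' → k ≤ μ.colLen 0 - 1 →
      k * t + (j + 1) ≤ k' * t + (j' + 1) → k ≤ k' := by
    intro j j' k k' hk' hk h
    -- If `k > k'`, the inequality forces `t ≤ j'`. Such a column has only its top cell, so `k'` is
    -- already the highest level.
    by_contra hlt
    have : (k' + 1) * t ≤ k * t := Nat.mul_le_mul_right t (by omega)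
    have := hcol1 j' (by nlinarith)
    omega
  -- Level `k` is row `μ.colLen 0 - 1 - k`; column `j` occupies the highest `μ.colLen j` levels.
  refine isVertexDecomposable_of_selections (fun j k => k * t + (j + 1))
    (Finset.range (μ.rowLen 0)) (fun j => μ.colLen 0 - μ.colLen j) (fun _ => μ.colLen 0 - 1)
    (fun i _ j _ hij => ?_) (fun _ _ _ _ _ => le_rfl) (fun j hj => ?_) ?_ _ fun σ => ?_
  · exact Nat.sub_le_sub_left (μ.colLen_anti i j hij) _
  · have := hcol j (Finset.mem_range.1 hj)
    omega
  · intro j _ j' _ k k' hk hk1 hk' hk1' h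
    obtain rfl : k = k' :=
      le_antisymm (hlevel j j' k k' hk' hk1 h.le) (hlevel j' j k' k hk hk1' h.ge)
    simpa using h
  · constructor
    · rintro ⟨_, ⟨a, ha, hrow, rfl⟩, hσ⟩
      choose i hi hai using hrow
      -- The value 0 beyond the last column plays no role.
      let k : ℕ → ℕ := fun j => if h : j < μ.rowLen 0 then μ.colLen 0 - 1 - i ⟨j, h⟩ else 0
      have hk : ∀ j (h : j < μ.rowLen 0), k j = μ.colLen 0 - 1 - i ⟨j, h⟩ := fun j h => dif_pos h
      have hak : ∀ j (h : j < μ.rowLen 0), a ⟨j, h⟩ = k j * t + (j + 1) := fun j h => by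
        rw [hai, hk j h, youngEntry]
      have hb : ∀ j < μ.rowLen 0, μ.colLen 0 - μ.colLen j ≤ k j ∧ k j ≤ μ.colLen 0 - 1 := by
        intro j h
        have := YoungDiagram.mem_iff_lt_colLen.1 (hi ⟨j, h⟩)
        rw [hk j h]
        dsimp only at this
        omega
      refine ⟨k, ⟨fun j hj j' hj' hjj => ?_, fun j hj => hb j (Finset.mem_range.1 hj)⟩, ?_⟩
      · have hj := Finset.mem_range.1 (Finset.mem_coe.1 hj)
        have hj' := Finset.mem_range.1 (Finset.mem_coe.1 hj')
        refine hlevel j j' _ _ (hb j' hj').1 (hb j hj).2 ?_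
        rw [← hak j hj, ← hak j' hj']
        exact ha.monotone hjj
      · refine hσ.trans fun y hy => ?_
        obtain ⟨j, -, rfl⟩ := Finset.mem_image.1 hy
        exact Finset.mem_image.2 ⟨j, Finset.mem_range.2 j.2, (hak j j.2).symm⟩
    · rintro ⟨k, ⟨hmono, hb⟩, hσ⟩
      refine ⟨_, ⟨fun j => k j * t + (j + 1), fun j j' hjj => ?_, fun j => ?_, rfl⟩, ?_⟩
      · have h := hmono (Finset.mem_coe.2 (Finset.mem_range.2 j.2))
          (Finset.mem_coe.2 (Finset.mem_range.2 j'.2)) hjj.le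
        have := Nat.mul_le_mul_right t h
        rw [Fin.lt_def] at hjj
        dsimp only
        omega
      · have h2 := hb j (Finset.mem_range.2 j.2)
        have h3 := hcol j j.2
        have h4 := hcol0 j
        dsimp only at h2
        refine ⟨μ.colLen 0 - 1 - k j, YoungDiagram.mem_iff_lt_colLen.2 (by omega), ?_⟩
        rw [youngEntry, Nat.sub_sub_self h2.2]
      · refine hσ.trans fun y hy => ?_
        obtain ⟨j, hj, rfl⟩ := Finset.mem_image.1 hy
        exact Finset.mem_image.2 ⟨⟨j, Finset.mem_range.1 hj⟩, Finset.mem_univ _, rfl⟩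

/-! ### The case λ₂ > t: a disconnected link. -/

/-- The intersection of two facets: the top row, and the second row continued by the end of the
top row. -/
def youngSeparator (t : ℕ) (μ : YoungDiagram) : Finset ℕ :=
  Finset.Ioc ((μ.colLen 0 - 1) * t) ((μ.colLen 0 - 2) * t + μ.rowLen 1) ∪
    Finset.Ioc ((μ.colLen 0 - 1) * t + μ.rowLen 1) ((μ.colLen 0 - 1) * t + μ.rowLen 0)

theorem two_le_colLen_zero (h1 : 0 < μ.rowLen 1) : 2 ≤ μ.colLen 0 :=
  lt_colLen_zero (YoungDiagram.mem_iff_lt_rowLen.2 h1)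

theorem pred_colLen_mul (t : ℕ) (h : 2 ≤ μ.colLen 0) :
    (μ.colLen 0 - 1) * t = (μ.colLen 0 - 2) * t + t := by
  rw [← Nat.succ_mul]
  congr 1
  omega

theorem Ioc_mem_youngFacets (t : ℕ) (μ : YoungDiagram) :
    Finset.Ioc ((μ.colLen 0 - 1) * t) ((μ.colLen 0 - 1) * t + μ.rowLen 0) ∈ youngFacets t μ := by
  refine ⟨fun j => youngEntry t μ 0 j, fun j k h => by simpa [youngEntry] using h,
    fun j => ⟨0, YoungDiagram.mem_iff_lt_rowLen.2 j.2, rfl⟩, ?_⟩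
  ext y
  simp only [Finset.mem_Ioc, Finset.mem_image, Finset.mem_univ, true_and, youngEntry, Nat.sub_zero]
  constructor
  · rintro ⟨h1, h2⟩
    exact ⟨⟨y - (μ.colLen 0 - 1) * t - 1, by omega⟩, by dsimp only; omega⟩
  · rintro ⟨j, rfl⟩
    have := j.2
    omega

theorem Ioc_union_Ioc_mem_youngFacets (h1 : 0 < μ.rowLen 1) :
    Finset.Ioc ((μ.colLen 0 - 2) * t) ((μ.colLen 0 - 2) * t + μ.rowLen 1) ∪
      Finset.Ioc ((μ.colLen 0 - 1) * t + μ.rowLen 1) ((μ.colLen 0 - 1) * t + μ.rowLen 0) ∈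
    youngFacets t μ := by
  have hA := pred_colLen_mul t (two_le_colLen_zero h1)
  have hmn := μ.rowLen_anti 0 1 (Nat.zero_le 1)
  refine ⟨fun j => youngEntry t μ (if (j : ℕ) < μ.rowLen 1 then 1 else 0) j, fun j k h => ?_,
    fun j => ⟨_, ?_, rfl⟩, ?_⟩
  · rw [Fin.lt_def] at h
    simp only [youngEntry]
    split_ifs <;> simp only [Nat.sub_sub, Nat.sub_zero, Nat.reduceAdd] <;> omega
  · split_ifs with h
    · exact YoungDiagram.mem_iff_lt_rowLen.2 h
    · exact YoungDiagram.mem_iff_lt_rowLen.2 j.2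
  · ext y
    simp only [Finset.mem_union, Finset.mem_Ioc, Finset.mem_image, Finset.mem_univ, true_and,
      youngEntry]
    constructor
    · rintro (⟨h2, h3⟩ | ⟨h2, h3⟩)
      · refine ⟨⟨y - (μ.colLen 0 - 2) * t - 1, by omega⟩, ?_⟩
        simp only [Nat.sub_sub, Nat.reduceAdd, if_pos (by omega :
            y - ((μ.colLen 0 - 2) * t + 1) < μ.rowLen 1)]
        omega
      · refine ⟨⟨y - (μ.colLen 0 - 1) * t - 1, by omega⟩, ?_⟩
        rw [if_neg (by dsimp only; omega), Nat.sub_zero]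
        dsimp only
        omega
    · rintro ⟨j, rfl⟩
      have := j.2
      split_ifs <;> simp only [Nat.sub_sub, Nat.sub_zero, Nat.reduceAdd] <;> omega

/-- The vertices outside the separator of a facet that contains it lie on one side of the smallest
entry of the top row. -/
theorem youngFacet_separated (h1 : t < μ.rowLen 1) {F : Finset ℕ} (hF : F ∈ youngFacets t μ)
    (hsep : youngSeparator t μ ⊆ F) {τ : Finset ℕ} (hτ : τ ⊆ F)
    (hdis : Disjoint τ (youngSeparator t μ)) :
    (∀ w ∈ τ, w ≤ (μ.colLen 0 - 1) * t) ∨ ∀ w ∈ τ, ¬ w ≤ (μ.colLen 0 - 1) * t := by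
  have hA := pred_colLen_mul t (two_le_colLen_zero (Nat.zero_lt_of_lt h1))
  obtain ⟨a, ha, hrow, rfl⟩ := hF
  choose i hi hai using hrow
  have hle : ∀ j, a j ≤ (μ.colLen 0 - 1) * t + (j + 1) := fun j => by
    rw [hai, youngEntry]
    exact Nat.add_le_add_right (Nat.mul_le_mul_right t (Nat.sub_le _ _)) _
  have hmem : ∀ y, (μ.colLen 0 - 1) * t < y → y ≤ (μ.colLen 0 - 2) * t + μ.rowLen 1 →
      ∃ j, a j = y := fun y h2 h3 => by
    obtain ⟨j, -, hj⟩ := Finset.mem_image.1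
      (hsep (Finset.mem_union_left _ (Finset.mem_Ioc.2 ⟨h2, h3⟩)))
    exact ⟨j, hj⟩
  -- Since `t < μ.rowLen 1`, the least entry of the top row is in the separator; `c` is the column
  -- where `F` takes it. This column is 0 or at least `t`.
  obtain ⟨c, hc⟩ := hmem ((μ.colLen 0 - 1) * t + 1) (Nat.lt_succ_self _) (by omega)
  have hci : (c : ℕ) = i c * t := by
    have h2 := hai c
    have h3 := lt_colLen_zero (hi c)
    have h4 : (μ.colLen 0 - 1) * t = (μ.colLen 0 - 1 - i c) * t + i c * t := by
      rw [← Nat.add_mul]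
      congr 1
      omega
    rw [hc, youngEntry] at h2
    omega
  rcases Nat.eq_zero_or_pos (i c) with hic | hic
  · rw [hic, Nat.zero_mul] at hci
    refine Or.inr fun w hw => ?_
    obtain ⟨j, -, rfl⟩ := Finset.mem_image.1 (hτ hw)
    have : a c ≤ a j := ha.monotone (by rw [Fin.le_def]; omega)
    omega
  · have htc : t ≤ c := hci ▸ Nat.le_mul_of_pos_left t hic
    refine Or.inl fun w hw => ?_
    obtain ⟨j, -, rfl⟩ := Finset.mem_image.1 (hτ hw)
    by_contra hj
    have hnot := Finset.disjoint_left.1 hdis hw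
    simp only [youngSeparator, Finset.mem_union, Finset.mem_Ioc, not_or, not_and] at hnot
    have hj2 := hle j
    have hjn := j.2
    -- From column `μ.rowLen 1` on only the top row is left, and its entries there belong to the
    -- separator.
    have hjm : (j : ℕ) < μ.rowLen 1 := by
      by_contra hjm
      have h2 := hai j
      rw [row_eq_zero (hi j) (not_lt.1 hjm), youngEntry, Nat.sub_zero] at h2
      omega
    -- The first block of the separator consists of `μ.rowLen 1 - t` consecutive integers, so it
    -- fills consecutive columns from `c ≥ t` on. An entry past the block is then in column
    -- `μ.rowLen 1` or later, contradicting `hjm`.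
    have hrun : ∀ e, e < μ.rowLen 1 - t → ∃ h : c + e < μ.rowLen 0,
        a ⟨c + e, h⟩ = (μ.colLen 0 - 1) * t + 1 + e := by
      intro e
      induction e with
      | zero => exact fun _ => ⟨c.2, hc⟩
      | succ e ih =>
        intro he
        obtain ⟨h, hae⟩ := ih (by omega)
        obtain ⟨d, hd⟩ := hmem ((μ.colLen 0 - 1) * t + 1 + (e + 1)) (by omega) (by omega)
        have hlt : (⟨c + e, h⟩ : Fin _) < d := ha.lt_iff_lt.1 (by omega)
        rw [Fin.lt_def] at hlt
        dsimp only at hlt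
        have hdn := d.2
        refine ⟨by omega, le_antisymm ?_ ?_⟩
        · rw [← hd]
          exact ha.monotone (by rw [Fin.le_def]; dsimp only; omega)
        · have := ha (a := ⟨c + e, h⟩) (b := ⟨c + (e + 1), by omega⟩)
            (by rw [Fin.lt_def]; dsimp only; omega)
          omega
    obtain ⟨h, hae⟩ := hrun (μ.rowLen 1 - t - 1) (by omega)
    have hlt : (⟨c + (μ.rowLen 1 - t - 1), h⟩ : Fin _) < j := ha.lt_iff_lt.1 (by omega)
    rw [Fin.lt_def] at hlt
    dsimp only at hlt
    omega

/-- If the second row is longer than `t`, the complex is not Cohen–Macaulay over any field. -/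
theorem not_youngComplex_isCohenMacaulay (K : Type*) [Field K] (ht : 2 ≤ t)
    (h1 : t < μ.rowLen 1) : ¬ (youngComplex t μ).IsCohenMacaulay K := by
  intro hCM
  have hpos := Nat.zero_lt_of_lt h1
  have hA := pred_colLen_mul t (two_le_colLen_zero hpos)
  have hmn := μ.rowLen_anti 0 1 (Nat.zero_le 1)
  set σ := youngSeparator t μ with hσ
  have hmem : ∀ y, y ∈ σ ↔
      (μ.colLen 0 - 1) * t < y ∧ y ≤ (μ.colLen 0 - 2) * t + μ.rowLen 1 ∨
      (μ.colLen 0 - 1) * t + μ.rowLen 1 < y ∧ y ≤ (μ.colLen 0 - 1) * t + μ.rowLen 0 := by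
    intro y
    rw [hσ, youngSeparator, Finset.mem_union, Finset.mem_Ioc, Finset.mem_Ioc]
  have hσface : σ ∈ (youngComplex t μ).faces :=
    ⟨_, Ioc_mem_youngFacets t μ, fun y hy => Finset.mem_Ioc.2 (by rw [hmem] at hy; omega)⟩
  have hlink : ∀ F ∈ youngFacets t μ, σ ⊆ F → ∀ τ ⊆ F, Disjoint τ σ →
      τ ∈ ((youngComplex t μ).link σ hσface).faces := fun F hF hσF τ hτF hdis =>
    ⟨⟨F, hF, hτF⟩, hdis, ⟨F, hF, Finset.union_subset hτF hσF⟩⟩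
  have hupper : ∀ τ : Finset ℕ, (∀ y ∈ τ, (μ.colLen 0 - 2) * t + μ.rowLen 1 < y ∧
      y ≤ (μ.colLen 0 - 1) * t + μ.rowLen 1) →
      τ ∈ ((youngComplex t μ).link σ hσface).faces := by
    intro τ hτ
    refine hlink _ (Ioc_mem_youngFacets t μ) (fun y hy => ?_) τ (fun y hy => ?_)
      (Finset.disjoint_left.2 fun y hy => ?_)
    · rw [hmem] at hy
      rw [Finset.mem_Ioc]
      omega
    · have := hτ y hy
      rw [Finset.mem_Ioc]
      omega
    · have := hτ y hy
      rw [hmem]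
      omega
  have hlower : {(μ.colLen 0 - 2) * t + 1} ∈ ((youngComplex t μ).link σ hσface).faces := by
    refine hlink _ (Ioc_union_Ioc_mem_youngFacets hpos) (fun y hy => ?_) _ ?_ ?_
    · rw [hmem] at hy
      rw [Finset.mem_union, Finset.mem_Ioc, Finset.mem_Ioc]
      omega
    · rw [Finset.singleton_subset_iff, Finset.mem_union, Finset.mem_Ioc, Finset.mem_Ioc]
      omega
    · rw [Finset.disjoint_singleton_left, hmem]
      omega
  refine not_subsingleton_reducedHomology_zero K
    (p := fun w => w ≤ (μ.colLen 0 - 1) * t) ?_ hlower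
    (hupper {(μ.colLen 0 - 2) * t + μ.rowLen 1 + 1} fun y hy => ?_) ?_ ?_ (hCM σ hσface 0 ?_)
  · rintro τ ⟨-, hdis, F, hF, hτF⟩
    exact youngFacet_separated h1 hF (Finset.union_subset_right hτF)
      (Finset.union_subset_left hτF) hdis
  · rw [Finset.mem_singleton] at hy
    omega
  · omega
  · omega
  -- The top row has `t ≥ 2` entries off the separator, so the link contains an edge and degree 0 is
  -- below its dimension.
  · have hpair := hupper
      {(μ.colLen 0 - 2) * t + μ.rowLen 1 + 1, (μ.colLen 0 - 2) * t + μ.rowLen 1 + 2} fun y hy => by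
        rw [Finset.mem_insert, Finset.mem_singleton] at hy
        omega
    have := Finset.le_sup (f := Finset.card) ((Set.Finite.mem_toFinset
      ((youngComplex t μ).link σ hσface).finite_faces).2 hpair)
    rw [Finset.card_pair (by omega)] at this
    rw [FiniteComplex.dim]
    omega

end YoungComplex

/-! ### The equivalence. -/

theorem mainTheorem3 (K : Type*) [Field K] (t : ℕ) (ht : 2 ≤ t) (μ : YoungDiagram) (hμ : μ ≠ ⊥) :
    List.TFAE [
      (youngComplex t μ).IsVertexDecomposable,
      (youngComplex t μ).IsShellable,
      (youngComplex t μ).IsCohenMacaulay K,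
      μ.colLen 0 = 1 ∨ (2 ≤ μ.colLen 0 ∧ μ.rowLen 1 ≤ t)] := by
  tfae_have 1 → 2 := fun h => h.isShellable (youngComplex_isPure t μ)
  tfae_have 2 → 3 := fun h => h.isCohenMacaulay K
  tfae_have 3 → 4 := fun h => by
    have h1 : μ.rowLen 1 ≤ t :=
      not_lt.1 fun h1 => not_youngComplex_isCohenMacaulay K ht h1 h
    have h0 : 0 < μ.colLen 0 := by
      obtain ⟨c, hc⟩ : μ.cells.Nonempty := by
        rw [Finset.nonempty_iff_ne_empty]
        exact fun h => hμ (YoungDiagram.ext h)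
      exact Nat.zero_lt_of_lt (lt_colLen_zero (i := c.1) (j := c.2) hc)
    omega
  tfae_have 4 → 1 := fun h => by
    refine youngComplex_isVertexDecomposable ?_
    rcases h with h | h
    · by_contra h1
      have := two_le_colLen_zero (μ := μ) (by omega)
      omega
    · exact h.2
  tfae_finish
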